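/- Let $n\ge 1$ and $s$ be integers with $0\le s\le n-1$, and let $F:\mathrm{GF}(2^n)\to\mathrm{GF}(2^n)$ be a function. For $a,b\in\mathrm{GF}(2^n)$ put $\delta(a,b)=\#\{x\in\mathrm{GF}(2^n): F(x+a)+F(x)=b\}$ and $W_F(a,b)=\sum_{x\in\mathrm{GF}(2^n)}(-1)^{\mathrm{Tr}(aF(x)+bx)}$, where $\mathrm{Tr}$ is the trace from $\mathrm{GF}(2^n)$ to $\mathrm{GF}(2)$. Let $$\mathcal C(F)=\left\{\left(\mathrm{Tr}(aF(x)+bx)+c\right)_{x\in\mathrm{GF}(2^n)} : a,b\in\mathrm{GF}(2^n),\ c\in\mathrm{GF}(2)\right\},$$ a binary linear code whose coordinate positions are the elements of $\mathrm{GF}(2^n)$, and let $\mathcal B_k(\mathcal C(F))$ be the multiset of the supports of the codewords of Hamming weight $k$ in $\mathcal C(F)$. A pair $(\mathcal P,\mathcal B)$ of a set $\mathcal P$ of $v$ points and a multiset $\mathcal B$ of $k$-subsets of $\mathcal P$ (blocks) is a $2$-$(v,k,\lambda)$ design if every $2$-subset of $\mathcal P$ is contained in exactly $\lambda$ blocks,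 counted with multiplicity. **Theorem.** Suppose that $F$ is differentially two-valued with $\{0,2^s\}$, that is, $\{\delta(a,b): a\in\mathrm{GF}(2^n)\setminus\{0\},\ b\in\mathrm{GF}(2^n)\}=\{0,2^s\}$, and that $W_F(a,b)\in\{0,2^{(n+s)/2},-2^{(n+s)/2}\}$ for all $a\in\mathrm{GF}(2^n)\setminus\{0\}$ and $b\in\mathrm{GF}(2^n)$. Then $(\mathrm{GF}(2^n),\mathcal B_k(\mathcal C(F)))$ is a $2$-$(2^n,k,\lambda)$ design for each of the following three pairs $(k,\lambda)$, all of whose entries are non-negative integers: 1. $k=2^{n-1}+2^{(n+s-2)/2}$ and $\lambda=\left(2^{n-s-1}+2^{(n-s-2)/2}\right)\left(2^{n-1}+2^{(n+s-2)/2}-1\right)$; 2. $k=2^{n-1}-2^{(n+s-2)/2}$ and $\lambda=\left(2^{n-s-1}-2^{(n-s-2)/2}\right)\left(2^{n-1}-2^{(n+s-2)/2}-1\right)$; 3. $k=2^{n-1}$ and $\lambda=(2^{n-1}-1)(2^n-2^{n-s}+1)$. -/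

import Mathlib

/-- `δ(a,b) = #{x : F(x+a) + F(x) = b}`. -/
noncomputable def diffCount {K : Type*} [Field K] (F : K → K) (a b : K) : ℕ :=
  Set.ncard {x : K | F (x + a) + F x = b}

/-- `F` is differentially two-valued with `{0, 2^s}`:
`{δ(a,b) : a ≠ 0, b} = {0, 2^s}` as sets. -/
def IsDiffTwoValued {K : Type*} [Field K] (F : K → K) (s : ℕ) : Prop :=
  {d : ℕ | ∃ a b : K, a ≠ 0 ∧ diffCount F a b = d} = {0, 2 ^ s}

/-- The Walsh transform `W_F(a,b) = ∑ₓ (-1)^{Tr(a F(x) + b x)}`, with `Tr` the absolute trace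
to `GF(2)`. -/
noncomputable def walsh {K : Type*} [Field K] [Fintype K] [Algebra (ZMod 2) K]
    (F : K → K) (a b : K) : ℤ :=
  ∑ x : K, (-1 : ℤ) ^ (Algebra.trace (ZMod 2) K (a * F x + b * x)).val

/-- The binary linear code `C(F) = {(Tr(a F(x) + b x) + c)ₓ : a, b ∈ K, c ∈ GF(2)}`, whose
coordinate positions are the elements of `K`. -/
noncomputable def codeOf {K : Type*} [Field K] [Algebra (ZMod 2) K] (F : K → K) :
    Submodule (ZMod 2) (K → ZMod 2) where
  carrier := {v | ∃ (a b : K) (c : ZMod 2),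
    v = fun x => Algebra.trace (ZMod 2) K (a * F x + b * x) + c}
  zero_mem' := ⟨0, 0, 0, by funext x; simp⟩
  add_mem' := by
    rintro _ _ ⟨a, b, c, rfl⟩ ⟨a', b', c', rfl⟩
    refine ⟨a + a', b + b', c + c', ?_⟩
    funext x
    simp only [Pi.add_apply, add_mul, map_add]
    ring
  smul_mem' := by
    rintro r _ ⟨a, b, c, rfl⟩
    refine ⟨r • a, r • b, r * c, ?_⟩
    funext x
    simp only [Pi.smul_apply, smul_eq_mul, smul_mul_assoc, map_add, map_smul]
    ring

open Classical in
/-- The support of a word, as a set of coordinate positions. -/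
noncomputable def wordSupport {P : Type*} [Fintype P] (c : P → ZMod 2) : Finset P :=
  Finset.univ.filter fun i => c i ≠ 0

open Classical in
/-- The multiset `B_w(C)` of the supports of the codewords of Hamming weight `w` of a binary
linear code `C`. (For codes over `GF(q)` multiplicities are divided by `q - 1`, which is `1`
here.) -/
noncomputable def codeBlocks {P : Type*} [Fintype P] (C : Submodule (ZMod 2) (P → ZMod 2))
    (w : ℕ) : Multiset (Finset P) :=
  (Finset.univ.filter fun c : P → ZMod 2 => c ∈ C ∧ hammingNorm c = w).val.map wordSupport

open Classical in
/-- `(P, B)` is a `t`-`(v, k, l)` design: `P` is a set of `v` points, `B` is a multiset of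
`k`-subsets of `P` (called blocks), and every `t`-subset of `P` is contained in exactly `l`
blocks, counted with multiplicity. The block size is positive unless there are no blocks. -/
structure IsDesign {P : Type*} [Fintype P] (t v k l : ℕ) (B : Multiset (Finset P)) : Prop where
  card_points : Fintype.card P = v
  one_le_t : 1 ≤ t
  t_le : t ≤ v
  k_le : k ≤ v
  one_le_k : B ≠ 0 → 1 ≤ k
  card_block : ∀ b ∈ B, b.card = k
  card_blocks_through : ∀ T : Finset P, T.card = t →
    Multiset.card (B.filter fun b => T ⊆ b) = l

/-! Write q = 2^n, ε_x for the sign (-1)^{Tr(aF(x)+bx)}, and v = q - 2k. Codewords of weight k are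
triples (a,b,c) with (-1)^c W(a,b) = v, and (1 - (-1)^c ε_x)/2 detects that x lies in the support.
Away from (0,0), W takes only the values 0, ±2^{(n+s)/2}, so the indicator of a given value, times
the squared amplitude, is a polynomial in W of degree at most 2. Counting the blocks through {x,y}
thus reduces to the sums over (a,b) of W ε_x, W² and W² ε_x ε_y. These follow from orthogonality of
characters (`sum_walsh_mul_walshSign`, `sum_walsh_sq`, `sum_walsh_sq_mul`). Only the last depends on
the pair, through δ(x+y, F(x)+F(y)), which is nonzero because y is a solution, hence equals 2^s. -/

/-- The sign `(-1)^z` of a bit `z`. -/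
def bitSign (z : ZMod 2) : ℤ := (-1) ^ z.val

lemma bitSign_add (z w : ZMod 2) : bitSign (z + w) = bitSign z * bitSign w := by
  revert z w; decide

lemma bitSign_mul_self (z : ZMod 2) : bitSign z * bitSign z = 1 := by
  revert z; decide

lemma bitSign_zero : bitSign 0 = 1 := rfl

lemma bitSign_one : bitSign 1 = -1 := rfl

lemma bitSign_eq_one_iff (z : ZMod 2) : bitSign z = 1 ↔ z = 0 := by
  revert z; decide

lemma one_sub_bitSign (z : ZMod 2) : 1 - bitSign z = if z ≠ 0 then 2 else 0 := by
  revert z; decide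

lemma sum_zmod_two {M : Type*} [AddCommMonoid M] (g : ZMod 2 → M) :
    ∑ c, g c = g 0 + g 1 := Fin.sum_univ_two g

/-! ### Orthogonality of characters and moments of the Walsh transform. -/

section Walsh

variable {K : Type*} [Field K] [Algebra (ZMod 2) K]

lemma charTwo_of_algebra : CharP K 2 :=
  charP_of_injective_algebraMap (algebraMap (ZMod 2) K).injective 2

/-- The character value `(-1)^{Tr(a F(x) + b x)}`. -/
noncomputable def walshSign (F : K → K) (a b x : K) : ℤ :=
  bitSign (Algebra.trace (ZMod 2) K (a * F x + b * x))

lemma walshSign_mul (F : K → K) (a b x y : K) :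
    walshSign F a b x * walshSign F a b y =
      bitSign (Algebra.trace (ZMod 2) K (a * (F x + F y) + b * (x + y))) := by
  rw [walshSign, walshSign, ← bitSign_add, ← map_add]
  ring_nf

lemma walshSign_mul_self (F : K → K) (a b x : K) :
    walshSign F a b x * walshSign F a b x = 1 := bitSign_mul_self _

lemma walshSign_zero (F : K → K) (x : K) : walshSign F 0 0 x = 1 := by
  simp [walshSign, bitSign_zero]

variable [Fintype K]

lemma walsh_eq_sum (F : K → K) (a b : K) : walsh F a b = ∑ x, walshSign F a b x := rfl

lemma exists_trace_mul_ne_zero {x : K} (hx : x ≠ 0) :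
    ∃ a, Algebra.trace (ZMod 2) K (a * x) ≠ 0 := by
  by_contra! h
  refine hx ((traceForm_nondegenerate (ZMod 2) K).1 x fun a => ?_)
  rw [Algebra.traceForm_apply, mul_comm]
  exact h a

-- For x ≠ 0, translating a by some a₀ with Tr(a₀x) ≠ 0 multiplies the sum by a sign other than 1,
-- so it vanishes.
open Classical in
lemma sum_bitSign_trace_mul (x : K) :
    ∑ a : K, bitSign (Algebra.trace (ZMod 2) K (a * x)) =
      if x = 0 then (Fintype.card K : ℤ) else 0 := by
  split_ifs with hx
  · simp [hx, bitSign_zero]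
  · obtain ⟨a₀, ha₀⟩ := exists_trace_mul_ne_zero hx
    have hsgn : bitSign (Algebra.trace (ZMod 2) K (a₀ * x)) ≠ 1 := fun h =>
      ha₀ ((bitSign_eq_one_iff _).1 h)
    have key := Equiv.sum_comp (Equiv.addLeft a₀)
      fun a : K => bitSign (Algebra.trace (ZMod 2) K (a * x))
    simp only [Equiv.coe_addLeft, add_mul, map_add, bitSign_add, ← Finset.mul_sum] at key
    refine (mul_eq_zero.1 ?_).resolve_left (sub_ne_zero.2 hsgn)
    rw [sub_mul, one_mul, key, sub_self]

open Classical in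
lemma sum_sum_bitSign_trace (A B : K) :
    ∑ a : K, ∑ b : K, bitSign (Algebra.trace (ZMod 2) K (a * A + b * B)) =
      if A = 0 ∧ B = 0 then (Fintype.card K : ℤ) ^ 2 else 0 := by
  simp only [map_add, bitSign_add, ← Finset.mul_sum, ← Finset.sum_mul, sum_bitSign_trace_mul]
  by_cases hA : A = 0 <;> by_cases hB : B = 0 <;> simp [hA, hB, sq]

open Classical in
lemma sum_walshSign_mul (F : K → K) (x y : K) :
    ∑ a : K, ∑ b : K, walshSign F a b x * walshSign F a b y =
      if x = y then (Fintype.card K : ℤ) ^ 2 else 0 := by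
  have := charTwo_of_algebra (K := K)
  simp only [walshSign_mul, sum_sum_bitSign_trace, CharTwo.add_eq_zero]
  refine if_congr ⟨fun h => h.2, fun h => ⟨by rw [h], h⟩⟩ rfl rfl

lemma sum_walsh_mul_walshSign (F : K → K) (x : K) :
    ∑ a : K, ∑ b : K, walsh F a b * walshSign F a b x = (Fintype.card K : ℤ) ^ 2 := by
  classical
  have h : ∀ a b : K, walsh F a b * walshSign F a b x =
      ∑ u, walshSign F a b u * walshSign F a b x := fun a b => by
    rw [walsh_eq_sum, Finset.sum_mul]
  simp only [h]
  rw [Finset.sum_congr rfl fun a _ => Finset.sum_comm, Finset.sum_comm]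
  simp [sum_walshSign_mul]

/-- Expanding the square gives a four-point character sum. Orthogonality keeps only the pairs (u, v)
with v = u + (x+y) and u counted by δ(x+y, F(x)+F(y)). -/
lemma sum_walsh_sq_mul (F : K → K) (x y : K) :
    ∑ a : K, ∑ b : K, walsh F a b ^ 2 * (walshSign F a b x * walshSign F a b y) =
      (Fintype.card K : ℤ) ^ 2 * diffCount F (x + y) (F x + F y) := by
  classical
  have := charTwo_of_algebra (K := K)
  have h : ∀ a b : K, walsh F a b ^ 2 * (walshSign F a b x * walshSign F a b y) =
      ∑ u, ∑ v, bitSign (Algebra.trace (ZMod 2) K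
        (a * (F u + F v + (F x + F y)) + b * (u + v + (x + y)))) := fun a b => by
    rw [walsh_eq_sum, sq, Finset.sum_mul_sum, Finset.sum_mul]
    refine Finset.sum_congr rfl fun u _ => ?_
    rw [Finset.sum_mul]
    refine Finset.sum_congr rfl fun v _ => ?_
    rw [walshSign_mul, walshSign_mul, ← bitSign_add, ← map_add]
    ring_nf
  simp only [h]
  rw [Finset.sum_congr rfl fun a _ => Finset.sum_comm, Finset.sum_comm]
  rw [Finset.sum_congr rfl fun u _ => (Finset.sum_congr rfl fun a _ => Finset.sum_comm).trans
    Finset.sum_comm]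
  simp only [sum_sum_bitSign_trace]
  have h2 : ∀ u v : K, (F u + F v + (F x + F y) = 0 ∧ u + v + (x + y) = 0) ↔
      (v = u + (x + y) ∧ F (u + (x + y)) + F u = F x + F y) := fun u v => by
    have e : u + v + (x + y) = 0 ↔ v = u + (x + y) := by
      rw [CharTwo.add_eq_zero]
      constructor
      · rintro h; rw [← h, ← add_assoc, CharTwo.add_self_eq_zero, zero_add]
      · rintro rfl; rw [← add_assoc, CharTwo.add_self_eq_zero, zero_add]
    rw [e, and_comm]
    refine and_congr_right ?_
    rintro rfl
    rw [CharTwo.add_eq_zero, add_comm (F u)]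
  simp only [h2, ite_and, Finset.sum_ite_eq', Finset.mem_univ, if_true]
  rw [diffCount, Set.ncard_eq_toFinset_card', ← Finset.sum_filter, Finset.sum_const,
    nsmul_eq_mul, mul_comm]
  simp

lemma diffCount_zero (F : K → K) : diffCount F 0 0 = Fintype.card K := by
  have := charTwo_of_algebra (K := K)
  simp [diffCount, CharTwo.add_self_eq_zero, Set.ncard_univ, Nat.card_eq_fintype_card]

lemma sum_walsh_sq (F : K → K) :
    ∑ a : K, ∑ b : K, walsh F a b ^ 2 = (Fintype.card K : ℤ) ^ 3 := by
  have := charTwo_of_algebra (K := K)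
  have h := sum_walsh_sq_mul F 0 0
  simp only [walshSign_mul_self, mul_one, CharTwo.add_self_eq_zero, diffCount_zero] at h
  rw [h]; ring

lemma walsh_zero_left (F : K → K) {b : K} (hb : b ≠ 0) : walsh F 0 b = 0 := by
  classical
  have h := sum_bitSign_trace_mul b
  rw [if_neg hb] at h
  rw [walsh_eq_sum, ← h]
  refine Finset.sum_congr rfl fun x _ => ?_
  rw [walshSign, zero_mul, zero_add, mul_comm]

lemma walsh_zero (F : K → K) : walsh F 0 0 = Fintype.card K := by
  simp [walsh_eq_sum, walshSign_zero]

end Walsh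

/-! ### Codewords, their weights and the blocks through a pair. -/

lemma sum_bitSign_eq {P : Type*} [Fintype P] (w : P → ZMod 2) :
    ∑ x, bitSign (w x) = Fintype.card P - 2 * hammingNorm w := by
  have h : ∀ x, bitSign (w x) = 1 - if w x ≠ 0 then 2 else 0 := fun x => by
    rw [← one_sub_bitSign]; ring
  simp only [h, Finset.sum_sub_distrib, ← Finset.sum_filter, Finset.sum_const, hammingNorm]
  simp [mul_comm]

lemma card_wordSupport {P : Type*} [Fintype P] (w : P → ZMod 2) :
    (wordSupport w).card = hammingNorm w := by
  rw [wordSupport, hammingNorm]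

section Codeword

variable {K : Type*} [Field K] [Algebra (ZMod 2) K]

/-- The codeword `(Tr(a F(x) + b x) + c)ₓ` of the triple `t = (a, b, c)`. -/
noncomputable def codeword (F : K → K) (t : K × K × ZMod 2) : K → ZMod 2 :=
  fun x => Algebra.trace (ZMod 2) K (t.1 * F x + t.2.1 * x) + t.2.2

lemma codeword_sub (F : K → K) (t t' : K × K × ZMod 2) :
    codeword F (t - t') = codeword F t - codeword F t' := by
  funext x
  simp only [codeword, Prod.fst_sub, Prod.snd_sub, Pi.sub_apply, sub_mul, map_add, map_sub]
  ring

lemma mem_codeOf_iff (F : K → K) (w : K → ZMod 2) :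
    w ∈ codeOf F ↔ ∃ t, codeword F t = w := by
  constructor
  · rintro ⟨a, b, c, rfl⟩
    exact ⟨(a, b, c), rfl⟩
  · rintro ⟨⟨a, b, c⟩, rfl⟩
    exact ⟨a, b, c, rfl⟩

lemma bitSign_codeword (F : K → K) (a b : K) (c : ZMod 2) (x : K) :
    bitSign (codeword F (a, b, c) x) = walshSign F a b x * bitSign c := bitSign_add _ _

variable [Fintype K]

lemma sum_bitSign_codeword (F : K → K) (a b : K) (c : ZMod 2) :
    ∑ x, bitSign (codeword F (a, b, c) x) = walsh F a b * bitSign c := by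
  simp only [bitSign_codeword, ← Finset.sum_mul, walsh_eq_sum]

lemma hammingNorm_codeword_eq_iff (F : K → K) (a b : K) (c : ZMod 2) (k : ℕ) :
    hammingNorm (codeword F (a, b, c)) = k ↔
      walsh F a b * bitSign c = Fintype.card K - 2 * k := by
  rw [← sum_bitSign_codeword, sum_bitSign_eq]
  omega

/-- By linearity only the kernel matters: a zero codeword would force |W(a,b)| = q. -/
lemma codeword_injective (F : K → K)
    (h : ∀ a b : K, (a, b) ≠ 0 → |walsh F a b| < Fintype.card K) :
    Function.Injective (codeword F) := by
  intro t t' ht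
  rw [← sub_eq_zero, ← codeword_sub] at ht
  rw [← sub_eq_zero]
  generalize t - t' = d at ht
  obtain ⟨a, b, c⟩ := d
  have hs := sum_bitSign_codeword F a b c
  simp only [ht, Pi.zero_apply, bitSign_zero, Finset.sum_const, Finset.card_univ,
    nsmul_eq_mul, mul_one] at hs
  have hab : (a, b) = 0 := by
    by_contra hne
    have hc : |bitSign c| = 1 := by clear hs ht; revert c; decide
    have := congrArg abs hs
    rw [abs_mul, hc, mul_one, Nat.abs_cast] at this
    exact (h a b hne).ne this.symm
  obtain ⟨rfl, rfl⟩ := Prod.mk_eq_zero.1 hab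
  have := congrFun ht 0
  simp only [codeword, zero_mul, add_zero, map_zero, zero_add, Pi.zero_apply] at this
  rw [this]
  rfl

open Classical in
lemma card_blocks_through_pair (F : K → K) (hinj : Function.Injective (codeword F)) (k : ℕ)
    (x y : K) :
    Multiset.card ((codeBlocks (codeOf F) k).filter fun B => {x, y} ⊆ B) =
      (Finset.univ.filter fun t : K × K × ZMod 2 => hammingNorm (codeword F t) = k ∧
        codeword F t x ≠ 0 ∧ codeword F t y ≠ 0).card := by
  rw [codeBlocks, Multiset.filter_map, Multiset.card_map, ← Finset.filter_val,
    Finset.card_val, Finset.filter_filter, ← Finset.card_map ⟨_, hinj⟩]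
  congr 1
  ext w
  simp only [Finset.mem_filter, Finset.mem_univ, true_and, Finset.mem_map,
    Function.Embedding.coeFn_mk, mem_codeOf_iff, Function.comp_apply, wordSupport,
    Finset.insert_subset_iff, Finset.singleton_subset_iff]
  constructor
  · rintro ⟨⟨⟨t, rfl⟩, h⟩, h'⟩
    exact ⟨t, ⟨h, h'⟩, rfl⟩
  · rintro ⟨t, ⟨h, h'⟩, rfl⟩
    exact ⟨⟨⟨t, rfl⟩, h⟩, h'⟩

-- The factor 4 clears the two halves in the support indicators (1 - sign)/2. The two summands are c
-- = 0 and c = 1, the latter negating both W and the signs.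
open Classical in
lemma four_mul_card_blocks_through_pair (F : K → K) (hinj : Function.Injective (codeword F))
    (k : ℕ) (x y : K) (v : ℤ) (hv : v = Fintype.card K - 2 * k) :
    (4 * Multiset.card ((codeBlocks (codeOf F) k).filter fun B => {x, y} ⊆ B) : ℤ) =
      ∑ a : K, ∑ b : K,
        ((if walsh F a b = v then (1 - walshSign F a b x) * (1 - walshSign F a b y) else 0) +
        (if walsh F a b = -v then (1 + walshSign F a b x) * (1 + walshSign F a b y) else 0)) := by
  rw [card_blocks_through_pair F hinj, Finset.card_filter, Nat.cast_sum, Finset.mul_sum,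
    Fintype.sum_prod_type]
  refine Finset.sum_congr rfl fun a _ => ?_
  rw [Fintype.sum_prod_type]
  refine Finset.sum_congr rfl fun b _ => ?_
  have term : ∀ c : ZMod 2, (4 * ((if hammingNorm (codeword F (a, b, c)) = k ∧
      codeword F (a, b, c) x ≠ 0 ∧ codeword F (a, b, c) y ≠ 0 then 1 else 0 : ℕ) : ℤ)) =
      if walsh F a b * bitSign c = v then
        (1 - walshSign F a b x * bitSign c) * (1 - walshSign F a b y * bitSign c) else 0 := by
    intro c
    simp only [hammingNorm_codeword_eq_iff, ← hv, ← bitSign_codeword, one_sub_bitSign]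
    split_ifs <;> simp_all
  simp only [term, sum_zmod_two, bitSign_zero, bitSign_one, mul_one, mul_neg, sub_neg_eq_add,
    neg_eq_iff_eq_neg]

end Codeword

/-! ### Pair counts and parity of the exponent. -/

lemma sum_sum_ite_zero {K : Type*} [Zero K] [Fintype K] [DecidableEq K] (r : ℤ) :
    ∑ a : K, ∑ b : K, (if a = 0 ∧ b = 0 then r else 0) = r := by
  simp [ite_and]

section Design

variable {K : Type*} [Field K] [Algebra (ZMod 2) K] [Fintype K]

open Classical in
lemma isDesign_codeBlocks (F : K → K) (n k l : ℕ) (hn : 1 ≤ n)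
    (hK : Fintype.card K = 2 ^ n) (hk : 1 ≤ k) (hk' : k ≤ Fintype.card K)
    (h : ∀ x y : K, x ≠ y →
      Multiset.card ((codeBlocks (codeOf F) k).filter fun B => {x, y} ⊆ B) = l) :
    IsDesign 2 (2 ^ n) k l (codeBlocks (codeOf F) k) where
  card_points := hK
  one_le_t := one_le_two
  t_le := Nat.le_self_pow (by omega) 2
  k_le := hK ▸ hk'
  one_le_k := fun _ => hk
  card_block := by
    intro B hB
    obtain ⟨w, hw, rfl⟩ := Multiset.mem_map.1 hB
    rw [card_wordSupport]
    exact (Finset.mem_filter.1 hw).2.2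
  card_blocks_through := by
    intro T hT
    obtain ⟨x, y, hxy, rfl⟩ := Finset.card_eq_two.1 hT
    exact h x y hxy

-- For W in {0, v, -v} the weighted indicators add up to W²(1 + ε_x ε_y) - vW(ε_x + ε_y). The last
-- term of the right-hand side removes the spurious value of this polynomial at (0,0), where W = q.
open Classical in
lemma sq_mul_four_mul_card_blocks_through_pair (F : K → K)
    (hinj : Function.Injective (codeword F)) (k : ℕ) (x y : K) (v : ℤ)
    (hv : v = Fintype.card K - 2 * k) (hv0 : v ≠ 0) (hvK : |v| < Fintype.card K)
    (hW : ∀ a b : K, (a, b) ≠ 0 → walsh F a b = 0 ∨ walsh F a b = v ∨ walsh F a b = -v) :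
    v ^ 2 * (4 * Multiset.card ((codeBlocks (codeOf F) k).filter fun B => {x, y} ⊆ B) : ℤ) =
      (Fintype.card K : ℤ) ^ 2 *
        (Fintype.card K + diffCount F (x + y) (F x + F y) - 2 * v) -
        (2 * (Fintype.card K : ℤ) ^ 2 - 2 * v * Fintype.card K) := by
  rw [four_mul_card_blocks_through_pair F hinj k x y v hv, Finset.mul_sum]
  have term : ∀ a b : K, v ^ 2 *
      ((if walsh F a b = v then (1 - walshSign F a b x) * (1 - walshSign F a b y) else 0) +
      (if walsh F a b = -v then (1 + walshSign F a b x) * (1 + walshSign F a b y) else 0)) =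
      walsh F a b ^ 2 + walsh F a b ^ 2 * (walshSign F a b x * walshSign F a b y) -
        v * (walsh F a b * walshSign F a b x) - v * (walsh F a b * walshSign F a b y) -
        (if a = 0 ∧ b = 0 then
          2 * (Fintype.card K : ℤ) ^ 2 - 2 * v * Fintype.card K else 0) := by
    intro a b
    by_cases hab : a = 0 ∧ b = 0
    · obtain ⟨rfl, rfl⟩ := hab
      have h := abs_lt.1 hvK
      rw [walsh_zero, walshSign_zero, walshSign_zero, if_neg (by omega), if_neg (by omega),
        if_pos ⟨rfl, rfl⟩]
      ring
    · rw [if_neg hab]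
      have hv2 : v ≠ -v := by omega
      have hv3 : (0 : ℤ) ≠ -v := by omega
      rcases hW a b (by simpa [Prod.ext_iff] using hab) with h | h | h <;> rw [h]
      · rw [if_neg hv0.symm, if_neg hv3]; ring
      · rw [if_pos rfl, if_neg hv2]; ring
      · rw [if_neg hv2.symm, if_pos rfl]; ring
  simp only [Finset.mul_sum, term]
  simp only [Finset.sum_sub_distrib, Finset.sum_add_distrib, sum_sum_ite_zero]
  simp only [← Finset.mul_sum, sum_walsh_sq, sum_walsh_sq_mul, sum_walsh_mul_walshSign]
  ring

-- Here v is the amplitude, not q - 2k = 0. The indicator of W = 0 times v² is v² - W², and both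
-- values of c contribute. Since x ≠ y, the sum of ε_x ε_y vanishes.
open Classical in
lemma sq_mul_four_mul_card_blocks_through_pair_of_half (F : K → K)
    (hinj : Function.Injective (codeword F)) (k : ℕ) (x y : K) (hxy : x ≠ y) (v : ℤ)
    (hk : (Fintype.card K : ℤ) = 2 * k) (hv0 : v ≠ 0)
    (hW : ∀ a b : K, (a, b) ≠ 0 → walsh F a b = 0 ∨ walsh F a b = v ∨ walsh F a b = -v) :
    v ^ 2 * (4 * Multiset.card ((codeBlocks (codeOf F) k).filter fun B => {x, y} ⊆ B) : ℤ) =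
      2 * (Fintype.card K : ℤ) ^ 2 *
        (v ^ 2 - Fintype.card K - diffCount F (x + y) (F x + F y)) -
        4 * (v ^ 2 - (Fintype.card K : ℤ) ^ 2) := by
  rw [four_mul_card_blocks_through_pair F hinj k x y 0 (by omega), Finset.mul_sum]
  have hK : (Fintype.card K : ℤ) ≠ 0 := by simp
  have term : ∀ a b : K, v ^ 2 *
      ((if walsh F a b = 0 then (1 - walshSign F a b x) * (1 - walshSign F a b y) else 0) +
      (if walsh F a b = -0 then (1 + walshSign F a b x) * (1 + walshSign F a b y) else 0)) =
      2 * v ^ 2 + 2 * v ^ 2 * (walshSign F a b x * walshSign F a b y) -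
        2 * walsh F a b ^ 2 -
        2 * (walsh F a b ^ 2 * (walshSign F a b x * walshSign F a b y)) -
        (if a = 0 ∧ b = 0 then 4 * (v ^ 2 - (Fintype.card K : ℤ) ^ 2) else 0) := by
    intro a b
    rw [neg_zero]
    by_cases hab : a = 0 ∧ b = 0
    · obtain ⟨rfl, rfl⟩ := hab
      rw [walsh_zero, walshSign_zero, walshSign_zero, if_neg hK, if_neg hK,
        if_pos ⟨rfl, rfl⟩]
      ring
    · rw [if_neg hab]
      rcases hW a b (by simpa [Prod.ext_iff] using hab) with h | h | h <;> rw [h]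
      · rw [if_pos rfl, if_pos rfl]; ring
      · rw [if_neg hv0, if_neg hv0]; ring
      · rw [if_neg (neg_ne_zero.2 hv0), if_neg (neg_ne_zero.2 hv0)]; ring
  simp only [Finset.mul_sum, term]
  simp only [Finset.sum_sub_distrib, Finset.sum_add_distrib, sum_sum_ite_zero]
  simp only [← Finset.mul_sum, sum_walsh_sq, sum_walsh_sq_mul, sum_walshSign_mul, if_neg hxy,
    Finset.sum_const, Finset.card_univ, nsmul_eq_mul]
  ring

lemma IsDiffTwoValued.diffCount_add {F : K → K} {s : ℕ} (hF : IsDiffTwoValued F s) {x y : K}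
    (hxy : x ≠ y) : diffCount F (x + y) (F x + F y) = 2 ^ s := by
  have := charTwo_of_algebra (K := K)
  have hmem : diffCount F (x + y) (F x + F y) ∈ ({0, 2 ^ s} : Set ℕ) := by
    rw [← hF]
    exact ⟨_, _, fun h => hxy (CharTwo.add_eq_zero.1 h), rfl⟩
  refine (Set.mem_insert_iff.1 hmem).resolve_left ?_
  rw [diffCount, Set.ncard_eq_zero]
  refine Set.Nonempty.ne_empty ⟨y, ?_⟩
  rw [Set.mem_ofPred_eq, add_comm x, ← add_assoc, CharTwo.add_self_eq_zero, zero_add]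

/-- Otherwise the sum of W² would be q², from (0,0) alone, instead of q³. -/
lemma exists_walsh_ne_zero (F : K → K) : ∃ a b : K, a ≠ 0 ∧ walsh F a b ≠ 0 := by
  by_contra! h
  classical
  have hsum := sum_walsh_sq F
  have term : ∀ a b : K, walsh F a b ^ 2 =
      if a = 0 ∧ b = 0 then (Fintype.card K : ℤ) ^ 2 else 0 := by
    intro a b
    by_cases ha : a = 0
    · subst ha
      by_cases hb : b = 0
      · simp [hb, walsh_zero]
      · simp [hb, walsh_zero_left]
    · simp [ha, h]
  simp only [term, sum_sum_ite_zero] at hsum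
  have hK : (1 : ℤ) < Fintype.card K := by exact_mod_cast Fintype.one_lt_card
  nlinarith [pow_pos (zero_lt_one.trans hK) 2]

lemma even_of_sq_eq_two_pow {w m : ℕ} (h : w ^ 2 = 2 ^ m) : Even m := by
  have := congrArg (fun t => t.factorization 2) h
  simp only [Nat.factorization_pow, Nat.prime_two.factorization, Finsupp.smul_apply,
    Finsupp.single_eq_same, smul_eq_mul, mul_one] at this
  exact ⟨_, by rw [← this]; ring⟩

/-- A nonzero Walsh value is an integer whose square is 2^(n+s). -/
lemma even_add_of_walsh {F : K → K} {n s : ℕ}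
    (hW : ∀ a b : K, a ≠ 0 →
      (walsh F a b : ℝ) ∈
        ({0, (2 : ℝ) ^ (((n : ℝ) + s) / 2), -(2 : ℝ) ^ (((n : ℝ) + s) / 2)} : Set ℝ)) :
    Even (n + s) := by
  obtain ⟨a, b, ha, hab⟩ := exists_walsh_ne_zero F
  have hsq : ((2 : ℝ) ^ (((n : ℝ) + s) / 2)) ^ 2 = 2 ^ (n + s) := by
    rw [← Real.rpow_natCast, ← Real.rpow_mul zero_le_two, ← Real.rpow_natCast]
    congr 1
    push_cast
    ring
  have h : (walsh F a b : ℝ) ^ 2 = 2 ^ (n + s) := by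
    rcases hW a b ha with h | h | h
    · exact absurd (by exact_mod_cast h) hab
    · rw [h, hsq]
    · rw [Set.mem_singleton_iff.1 h, neg_sq, hsq]
  refine even_of_sq_eq_two_pow (w := (walsh F a b).natAbs) ?_
  zify
  rw [sq_abs]
  exact_mod_cast h

end Design

/-! ### The three designs. -/

theorem mainTheorem7 {K : Type*} [Field K] [Fintype K] [Algebra (ZMod 2) K] (n s : ℕ)
    (hK : Fintype.card K = 2 ^ n) (hs : s < n) (F : K → K)
    (hF : IsDiffTwoValued F s)
    (hW : ∀ a b : K, a ≠ 0 →
      (walsh F a b : ℝ) ∈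
        ({0, (2 : ℝ) ^ (((n : ℝ) + s) / 2), -(2 : ℝ) ^ (((n : ℝ) + s) / 2)} : Set ℝ)) :
    (∃ k l : ℕ,
      (k : ℝ) = (2 : ℝ) ^ ((n : ℝ) - 1) + (2 : ℝ) ^ (((n : ℝ) + s - 2) / 2) ∧
      (l : ℝ) = ((2 : ℝ) ^ ((n : ℝ) - s - 1) + (2 : ℝ) ^ (((n : ℝ) - s - 2) / 2)) *
        ((2 : ℝ) ^ ((n : ℝ) - 1) + (2 : ℝ) ^ (((n : ℝ) + s - 2) / 2) - 1) ∧
      IsDesign 2 (2 ^ n) k l (codeBlocks (codeOf F) k)) ∧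
    (∃ k l : ℕ,
      (k : ℝ) = (2 : ℝ) ^ ((n : ℝ) - 1) - (2 : ℝ) ^ (((n : ℝ) + s - 2) / 2) ∧
      (l : ℝ) = ((2 : ℝ) ^ ((n : ℝ) - s - 1) - (2 : ℝ) ^ (((n : ℝ) - s - 2) / 2)) *
        ((2 : ℝ) ^ ((n : ℝ) - 1) - (2 : ℝ) ^ (((n : ℝ) + s - 2) / 2) - 1) ∧
      IsDesign 2 (2 ^ n) k l (codeBlocks (codeOf F) k)) ∧
    (∃ k l : ℕ,
      (k : ℝ) = (2 : ℝ) ^ ((n : ℝ) - 1) ∧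
      (l : ℝ) = ((2 : ℝ) ^ ((n : ℝ) - 1) - 1) *
        ((2 : ℝ) ^ (n : ℝ) - (2 : ℝ) ^ ((n : ℝ) - s) + 1) ∧
      IsDesign 2 (2 ^ n) k l (codeBlocks (codeOf F) k)) := by
  -- As n - s is even and positive, every exponent becomes integral: with A = 2^s and R = 2^r, q =
  -- 4AR² and the amplitude is 2AR.
  obtain ⟨r, rfl⟩ : ∃ r, n = s + 2 * r + 2 := by
    obtain ⟨j, hj⟩ := even_add_of_walsh hW
    exact ⟨j - s - 1, by omega⟩
  obtain ⟨A, hA⟩ : ∃ A, A = 2 ^ s := ⟨_, rfl⟩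
  obtain ⟨R, hR⟩ : ∃ R, R = 2 ^ r := ⟨_, rfl⟩
  have hA1 : 1 ≤ A := hA ▸ Nat.one_le_two_pow
  have hR1 : 1 ≤ R := hR ▸ Nat.one_le_two_pow
  have hAR : 1 ≤ A * R := Nat.mul_pos hA1 hR1
  have hle : A * R ≤ A * R ^ 2 := Nat.mul_le_mul_left _ (Nat.le_self_pow two_ne_zero R)
  have hcard : Fintype.card K = 4 * (A * R ^ 2) := by rw [hK, hA, hR]; ring
  have rpow_eq : ∀ (t : ℝ) (j : ℕ), t = j → (2 : ℝ) ^ t = 2 ^ j := by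
    rintro _ j rfl
    exact Real.rpow_natCast 2 j
  have e₁ : (2 : ℝ) ^ (((s + 2 * r + 2 : ℕ) : ℝ) - 1) = 2 * (A * R ^ 2 : ℕ) := by
    rw [rpow_eq _ (s + 2 * r + 1) (by push_cast; ring), hA, hR]; push_cast; ring
  have e₂ : (2 : ℝ) ^ ((((s + 2 * r + 2 : ℕ) : ℝ) + s - 2) / 2) = (A * R : ℕ) := by
    rw [rpow_eq _ (s + r) (by push_cast; ring), hA, hR]; push_cast; ring
  have e₃ : (2 : ℝ) ^ (((s + 2 * r + 2 : ℕ) : ℝ) - s - 1) = 2 * R ^ 2 := by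
    rw [rpow_eq _ (2 * r + 1) (by push_cast; ring), hR]; push_cast; ring
  have e₄ : (2 : ℝ) ^ ((((s + 2 * r + 2 : ℕ) : ℝ) - s - 2) / 2) = R := by
    rw [rpow_eq _ r (by push_cast; ring), hR]; push_cast; ring
  have e₅ : (2 : ℝ) ^ (((s + 2 * r + 2 : ℕ) : ℝ) - s) = 4 * R ^ 2 := by
    rw [rpow_eq _ (2 * r + 2) (by push_cast; ring), hR]; push_cast; ring
  have e₆ : (2 : ℝ) ^ ((s + 2 * r + 2 : ℕ) : ℝ) = 4 * (A * R ^ 2 : ℕ) := by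
    rw [rpow_eq _ _ rfl, hA, hR]; push_cast; ring
  have e₇ : (2 : ℝ) ^ ((((s + 2 * r + 2 : ℕ) : ℝ) + s) / 2) = 2 * (A * R : ℕ) := by
    rw [rpow_eq _ (s + r + 1) (by push_cast; ring), hA, hR]; push_cast; ring
  rw [e₁, e₂, e₃, e₄, e₅, e₆]
  have hW' : ∀ a b : K, (a, b) ≠ 0 → walsh F a b = 0 ∨
      walsh F a b = 2 * (A * R : ℕ) ∨ walsh F a b = -(2 * (A * R : ℕ)) := by
    intro a b hab
    by_cases ha : a = 0
    · subst ha
      exact Or.inl (walsh_zero_left F fun hb => hab (by rw [hb]; rfl))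
    · have h := hW a b ha
      rw [e₇] at h
      rcases h with h | h | h
      · exact Or.inl (by exact_mod_cast h)
      · exact Or.inr (Or.inl (by exact_mod_cast h))
      · rw [Set.mem_singleton_iff] at h
        exact Or.inr (Or.inr (by exact_mod_cast h))
  have hinj : Function.Injective (codeword F) := codeword_injective F fun a b hab => by
    rw [hcard, abs_lt]
    rcases hW' a b hab with h | h | h <;> rw [h] <;> omega
  have hcardZ : (Fintype.card K : ℤ) = 4 * (A * R ^ 2) := by exact_mod_cast hcard
  have hAZ : (A : ℤ) ≠ 0 := by omega
  have hRZ : (R : ℤ) ≠ 0 := by omega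
  have hdiff : ∀ x y : K, x ≠ y → (diffCount F (x + y) (F x + F y) : ℤ) = A := fun x y hxy => by
    rw [hF.diffCount_add hxy, hA]
  -- This is 4v² for v = ±2AR, the factor to cancel from the pair counts.
  have hpos : ((4 * A ^ 2 * R ^ 2 * 4 : ℕ) : ℤ) ≠ 0 := by
    push_cast
    positivity
  refine ⟨⟨2 * (A * R ^ 2) + A * R, R * (2 * R + 1) * (2 * (A * R ^ 2) + A * R - 1),
      ?_, ?_, ?_⟩,
    ⟨2 * (A * R ^ 2) - A * R, R * (2 * R - 1) * (2 * (A * R ^ 2) - A * R - 1), ?_, ?_, ?_⟩,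
    ⟨2 * (A * R ^ 2), (2 * (A * R ^ 2) - 1) * (4 * (A * R ^ 2) - 4 * R ^ 2 + 1), ?_, ?_, ?_⟩⟩
  · push_cast; ring
  · rw [Nat.cast_mul, Nat.cast_sub (by omega)]
    push_cast; ring
  · refine isDesign_codeBlocks F _ _ _ (by omega) hK (by omega) (by omega) fun x y hxy => ?_
    -- The weight exceeds q/2, so v = q - 2k is negative.
    have h := sq_mul_four_mul_card_blocks_through_pair F hinj (2 * (A * R ^ 2) + A * R) x y
      (-(2 * (A * R : ℕ))) (by rw [hcard]; push_cast; ring) (by omega)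
      (by rw [hcard, abs_lt]; omega)
      fun a b hab => by rw [neg_neg, or_comm (a := _ = -_)]; exact hW' a b hab
    rw [hdiff x y hxy, hcardZ] at h
    zify [show 1 ≤ 2 * (A * R ^ 2) + A * R by omega]
    refine mul_left_cancel₀ hpos ?_
    push_cast at h ⊢
    linear_combination h
  · rw [Nat.cast_sub (by omega)]
    push_cast; ring
  · rw [Nat.cast_mul, Nat.cast_mul, Nat.cast_sub (by omega), Nat.cast_sub (by omega),
      Nat.cast_sub (by omega)]
    push_cast; ring
  · refine isDesign_codeBlocks F _ _ _ (by omega) hK (by omega) (by omega) fun x y hxy => ?_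
    have h := sq_mul_four_mul_card_blocks_through_pair F hinj (2 * (A * R ^ 2) - A * R) x y
      (2 * (A * R : ℕ)) (by rw [hcard]; omega) (by omega)
      (by rw [hcard, abs_lt]; omega) hW'
    rw [hdiff x y hxy, hcardZ] at h
    zify [show 1 ≤ 2 * (A * R ^ 2) - A * R by omega, show A * R ≤ 2 * (A * R ^ 2) by omega,
      show 1 ≤ 2 * R by omega]
    refine mul_left_cancel₀ hpos ?_
    push_cast at h ⊢
    linear_combination h
  · push_cast; ring
  -- This bound keeps the truncated subtraction in λ exact.
  · have hR2 : R ^ 2 ≤ A * R ^ 2 := Nat.le_mul_of_pos_left _ hA1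
    rw [Nat.cast_mul, Nat.cast_add, Nat.cast_sub (by omega), Nat.cast_sub (by omega)]
    push_cast; ring
  · refine isDesign_codeBlocks F _ _ _ (by omega) hK (by omega) (by omega) fun x y hxy => ?_
    have hR2 : R ^ 2 ≤ A * R ^ 2 := Nat.le_mul_of_pos_left _ hA1
    have h := sq_mul_four_mul_card_blocks_through_pair_of_half F hinj (2 * (A * R ^ 2)) x y hxy
      (2 * (A * R : ℕ)) (by rw [hcard]; push_cast; ring) (by omega) hW'
    rw [hdiff x y hxy, hcardZ] at h
    zify [show 1 ≤ 2 * (A * R ^ 2) by omega, show 4 * R ^ 2 ≤ 4 * (A * R ^ 2) by omega]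
    refine mul_left_cancel₀ hpos ?_
    push_cast at h ⊢
    linear_combination h
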